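/- Let $\Omega\subset\mathbb{R}^N$ be open and bounded. Let $J\in C^1(\mathbb{R}^N)$ be non-negative and even with $J(0)>0$ and $\int_{\mathbb{R}^N}J=1$. Let $\mathcal X\in L^\infty(\mathbb{R}^N)$ satisfy $\mathcal X\ge c>0$ in $\Omega$ for some constant $c$, $\mathcal X=0$ in $\mathbb{R}^N\setminus\Omega$, and $\mathcal X|_\Omega\in C^1(\Omega)$. Let $u_0\in L^2(\Omega)\cap C^1(\Omega)$, and let $g:\mathbb{R}\to\mathbb{R}$ be of class $C^2$ and globally Lipschitz. Let $h_0$ be either $$h_0\equiv 1\ \text{ (Dirichlet)}\qquad\text{or}\qquad h_0(x)=\int_{\mathbb{R}^N}J(x-y)\bigl(1-\chi_\Omega(y)+\mathcal X(y)\bigr)\,dy\ \text{ (Neumann)}.$$ For a map $F$ taking $u\in L^2(\mathbb{R}^N)$ to a function $F(\cdot,u)$ on $\Omega$, a solution of the problem with reaction $F$ is a $u\in C^1(\mathbb{R};L^2(\mathbb{R}^N))$ such that $$u_t(x,t)=\mathcal X(x)\int_{\mathbb{R}^N}J(x-y)\,u(y,t)\,dy-h_0(x)\,u(x,t)+\mathcal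 X(x)\,F(x,u(\cdot,t))$$ for all $t\in\mathbb{R}$ and a.e. $x\in\Omega$, where $u_t$ is the derivative of the $L^2$-valued map $t\mapsto u(\cdot,t)$; $u(\cdot,t)=0$ a.e. in $\mathbb{R}^N\setminus\Omega$ for all $t$; and $u(\cdot,0)=\mathcal X u_0$ a.e. in $\Omega$. For every $\delta>0$ the problem with the nonlocal reaction $$F(x,u)=g\left(\frac{1}{\int_{B_\delta(x)}\mathcal X(y)\,dy}\int_{B_\delta(x)}u(y)\,dy\right)$$ has exactly one solution $u^\delta$. Moreover, there exists $\bar u\in C^1(\mathbb{R};L^2(\mathbb{R}^N))$, vanishing in $\mathbb{R}^N\setminus\Omega$, such that for every interval $[a,b]\subset\mathbb{R}$ $$u^\delta\rightharpoonup\bar u\quad\text{weakly}^*\text{ in }L^\infty([a,b];L^2(\Omega))\text{ as }\delta\to0^+,$$ that is, $\int_a^b\int_\Omega\varphi\,u^\delta\,dx\,dt\to\int_a^b\int_\Omega\varphi\,\bar u\,dx\,dt$ for all $\varphi\in L^1([a,b];L^2(\Omega))$. The limit $\bar u$ is a solution of the problem with the local reaction $F(x,u)=g\bigl(u(x)/\mathcal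 X(x)\bigr)$, i.e. $$\bar u_t(x,t)=\mathcal X(x)\int_{\mathbb{R}^N}J(x-y)\,\bar u(y,t)\,dy-h_0(x)\,\bar u(x,t)+\mathcal X(x)\,g\left(\frac{\bar u(x,t)}{\mathcal X(x)}\right)\quad\text{in }\Omega,$$ with $\bar u(x,t)=0$ in $\mathbb{R}^N\setminus\Omega$ and $\bar u(x,0)=\mathcal X(x)u_0(x)$. -/

import Mathlib

open MeasureTheory Filter Topology
open scoped ENNReal NNReal

noncomputable section

namespace NonlocalPerforated

/-- The space `ℝ^N` with its Euclidean norm. -/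
abbrev E (N : ℕ) : Type := EuclideanSpace ℝ (Fin N)

/-- The Hilbert space `L²(ℝ^N)`. -/
abbrev L2 (N : ℕ) : Type := Lp ℝ 2 (volume : Measure (E N))

/-- Hypothesis `(H_J)` on the kernel: continuous, non-negative, `J(0) > 0`, even, total mass one. -/
structure IsKernel {N : ℕ} (J : E N → ℝ) : Prop where
  continuous : Continuous J
  nonneg : ∀ x, 0 ≤ J x
  pos_zero : 0 < J 0
  even : ∀ x, J (-x) = J x
  integrable : Integrable J volume
  integral_eq_one : ∫ x, J x = 1

/-- Standing assumptions on the limit `X` of the characteristic functions: `X ∈ L^∞(ℝ^N)`,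
`X ≥ c > 0` in `Ω` and `X = 0` outside `Ω`. -/
structure IsDensity {N : ℕ} (Ω : Set (E N)) (X : E N → ℝ) : Prop where
  memLp_top : MemLp X ∞ (volume : Measure (E N))
  bounded_below : ∃ c : ℝ, 0 < c ∧ ∀ x ∈ Ω, c ≤ X x
  eq_zero : ∀ x, x ∉ Ω → X x = 0

/-- The Dirichlet coefficient `h₀ ≡ 1`. -/
def hDirichlet {N : ℕ} : E N → ℝ := fun _ => 1

/-- The Neumann coefficient `h₀(x) = ∫ J(x-y) (1 - χ_Ω(y) + X(y)) dy`. -/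
def hNeumann {N : ℕ} (Ω : Set (E N)) (J X : E N → ℝ) : E N → ℝ :=
  fun x => ∫ y, J (x - y) * (1 - Ω.indicator (fun _ => (1 : ℝ)) y + X y)

/-- The weighted mean `m_X(x,u) = (∫_{B_δ(x)} X)⁻¹ ∫_{B_δ(x)} u`. -/
def mean {N : ℕ} (X : E N → ℝ) (δ : ℝ) (u : E N → ℝ) (x : E N) : ℝ :=
  (∫ y in Metric.ball x δ, X y)⁻¹ * ∫ y in Metric.ball x δ, u y

/-- The nonlocal reaction `f_X(x,u) = g(m_X(x,u))`. -/
def nonlocalReaction {N : ℕ} (X : E N → ℝ) (g : ℝ → ℝ) (δ : ℝ) (u : E N → ℝ) (x : E N) : ℝ :=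
  g (mean X δ u x)

/-- The local reaction `g(u(x)/X(x))`. -/
def localReaction {N : ℕ} (X : E N → ℝ) (g : ℝ → ℝ) (u : E N → ℝ) (x : E N) : ℝ :=
  g (u x / X x)

/-- `u ∈ C¹(ℝ, L²(ℝ^N))` (equivalently, `C¹` on every bounded time interval) is a global solution
of `u_t = X ∫ J(x-y) u(y,t) dy - h₀ u + X F(u)` in `Ω`, `u = 0` outside `Ω`, `u(0) = X u₀`.
The time derivative is the derivative of the `L²`-valued map `t ↦ u(·,t)`. -/
structure IsSolution {N : ℕ} (Ω : Set (E N)) (J X h₀ u₀ : E N → ℝ)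
    (F : (E N → ℝ) → E N → ℝ) (u : ℝ → L2 N) : Prop where
  contDiff : ContDiff ℝ 1 u
  eq_zero : ∀ t, ∀ᵐ x ∂(volume : Measure (E N)), x ∉ Ω → u t x = 0
  initial : ∀ᵐ x ∂(volume : Measure (E N)), x ∈ Ω → u 0 x = X x * u₀ x
  equation : ∀ t, ∀ᵐ x ∂(volume : Measure (E N)), x ∈ Ω →
    deriv u t x = X x * (∫ y, J (x - y) * u t y) - h₀ x * u t x + X x * F (u t) x

/-- Weak* convergence `u^δ ⇀ v` in `L^∞([a,b]; L²(Ω))` as `δ → 0⁺`, i.e. convergence of the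
pairings with every `φ` in the predual `L¹([a,b]; L²(Ω))`. -/
def WeakStarTendsto {N : ℕ} (Ω : Set (E N)) (a b : ℝ) (u : ℝ → ℝ → L2 N) (v : ℝ → L2 N) : Prop :=
  ∀ φ : ℝ → Lp ℝ 2 ((volume : Measure (E N)).restrict Ω),
    IntegrableOn φ (Set.Icc a b) volume →
    Tendsto (fun δ : ℝ => ∫ t in Set.Icc a b, ∫ x in Ω, φ t x * u δ t x) (𝓝[>] 0)
      (𝓝 (∫ t in Set.Icc a b, ∫ x in Ω, φ t x * v t x))

end NonlocalPerforated

end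

noncomputable section

namespace NonlocalPerforated

/-! ### Ordinary differential equations with globally Lipschitz vector fields -/

section ODE

/-! Every problem here is an autonomous ODE `u' = V (u)` in `L²(ℝ^N)` with a globally Lipschitz
field: convolution with `J` and multiplication by `X` and `1_Ω h₀` are bounded operators, and `g`
acts on `L²` as a Lipschitz map (`isSolution_iff`, `lipschitzWith_vectorField`). The reaction is `X
g(B u)`, where `B` is an averaging operator `M δ` for the nonlocal problem and division by `X` for
the local one. Existence is a Picard argument on the whole line, and uniqueness is Gronwall.

The limit rests on two facts about the averages: `‖M δ‖` is bounded independently of `δ`, by Schur's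
test and a covering argument that asks no regularity of `∂Ω` (`exists_meanOperator`), and `M δ f → f
/ X` strongly for each fixed `f` (`tendsto_meanOperator`). The fields are therefore equi-Lipschitz
and converge pointwise, hence uniformly on the compact arcs of the limiting trajectory, and Gronwall
gives convergence in `C([a,b]; L²)` (`tendstoUniformlyOn_of_equiLipschitz`). This strong convergence
makes it possible to pass to the limit inside the nonlinearity `g`, and it implies the weak*
statement. -/

/-- A family of equi-Lipschitz maps converging pointwise converges uniformly on compact sets. -/
lemma eventually_forall_dist_le_of_equiLipschitz {α ι : Type*} [PseudoMetricSpace α] {l : Filter ι} {K : ℝ≥0}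
    {V : ι → α → α} {V₀ : α → α} (hV : ∀ᶠ i in l, LipschitzWith K (V i))
    (hV₀ : LipschitzWith K V₀) (hlim : ∀ x, Tendsto (fun i => V i x) l (𝓝 (V₀ x)))
    {S : Set α} (hS : IsCompact S) {ε : ℝ} (hε : 0 < ε) :
    ∀ᶠ i in l, ∀ x ∈ S, dist (V i x) (V₀ x) ≤ ε := by
  set η : ℝ := ε / (2 * (K + 1)) with hη_def
  have hη : 0 < η := by positivity
  obtain ⟨T, -, hTf, hTc⟩ := hS.finite_cover_balls hη
  have h1 : ∀ᶠ i in l, ∀ y ∈ T, dist (V i y) (V₀ y) < η := by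
    rw [hTf.eventually_all]
    exact fun y _ => Metric.tendsto_nhds.1 (hlim y) η hη
  filter_upwards [hV, h1] with i hi hiT x hx
  obtain ⟨y, hy, hxy⟩ := Set.mem_iUnion₂.1 (hTc hx)
  rw [Metric.mem_ball] at hxy
  have a1 := hi.dist_le_mul x y
  have a2 := hV₀.dist_le_mul x y
  have a3 := (hiT y hy).le
  have a4 := dist_triangle4 (V i x) (V i y) (V₀ y) (V₀ x)
  rw [dist_comm (V₀ y)] at a4
  have a5 := mul_le_mul_of_nonneg_left hxy.le K.coe_nonneg
  have a6 : η * (2 * (K + 1)) = ε := by rw [hη_def]; field_simp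
  nlinarith

variable {F : Type*} [NormedAddCommGroup F] [NormedSpace ℝ F]

/-- Integrating against the weight `exp (lam |s|)` gains a factor `1 / lam`. A large `lam` thus
makes the Picard map a contraction on all of `ℝ` at once. Negative times reduce to positive ones by
reflection. -/
lemma norm_intervalIntegral_le_of_exp_bound {h : ℝ → F} {C lam : ℝ} (hlam : 0 < lam) (hC : 0 ≤ C)
    (hh : ∀ s, ‖h s‖ ≤ C * Real.exp (lam * |s|)) (t : ℝ) :
    ‖∫ s in (0 : ℝ)..t, h s‖ ≤ C / lam * Real.exp (lam * |t|) := by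
  have key : ∀ (k : ℝ → F), (∀ s, ‖k s‖ ≤ C * Real.exp (lam * |s|)) → ∀ r : ℝ, 0 ≤ r →
      ‖∫ s in (0 : ℝ)..r, k s‖ ≤ C / lam * Real.exp (lam * |r|) := by
    intro k hk r hr
    have h1 : ‖∫ s in (0 : ℝ)..r, k s‖ ≤ ∫ s in (0 : ℝ)..r, C * Real.exp (lam * s) := by
      refine intervalIntegral.norm_integral_le_of_norm_le hr ?_
        (Continuous.intervalIntegrable (by fun_prop) _ _)
      refine Eventually.of_forall fun s hs => ?_
      have := hk s
      rwa [abs_of_pos hs.1] at this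
    have h2 : ∫ s in (0 : ℝ)..r, C * Real.exp (lam * s)
        = C / lam * (Real.exp (lam * r) - 1) := by
      have hd : ∀ s ∈ Set.uIcc 0 r, HasDerivAt (fun s => C / lam * Real.exp (lam * s))
          (C * Real.exp (lam * s)) s := by
        intro s _
        have := (((hasDerivAt_id s).const_mul lam).exp).const_mul (C / lam)
        refine this.congr_deriv ?_
        field_simp
        simp
      rw [intervalIntegral.integral_eq_sub_of_hasDerivAt hd
        (Continuous.intervalIntegrable (by fun_prop) _ _)]
      simp
      ring
    rw [h2] at h1
    rw [abs_of_nonneg hr]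
    have : 0 ≤ C / lam := by positivity
    nlinarith
  rcases le_total 0 t with ht | ht
  · exact key h hh t ht
  · have h1 := key (fun s => h (-s)) (fun s => by simpa using hh (-s)) (-t) (by linarith)
    rw [intervalIntegral.integral_comp_neg, neg_neg, neg_zero, intervalIntegral.integral_symm,
      norm_neg, abs_neg] at h1
    exact h1

open BoundedContinuousFunction in
/-- A globally Lipschitz vector field on a Banach space has global integral curves. -/
theorem exists_forall_hasDerivAt_of_lipschitzWith [CompleteSpace F] {K : ℝ≥0} {V : F → F}
    (hV : LipschitzWith K V) (x₀ : F) :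
    ∃ u : ℝ → F, u 0 = x₀ ∧ ∀ t, HasDerivAt u (V (u t)) t := by
  -- Any `lam > K` would do: the contraction constant is `K / lam`.
  set lam : ℝ := K + 1 with hlam_def
  have hlam : 0 < lam := by positivity
  have hVb : ∀ x, ‖V x‖ ≤ ‖V 0‖ + K * ‖x‖ := by
    intro x
    have h1 := hV.dist_le_mul x 0
    rw [dist_eq_norm, dist_zero_right] at h1
    have := norm_le_insert' (V x) (V 0)
    linarith
  -- The unknown is `w = exp (-lam |t|) u`, so the sup norm of `w` is an exponentially weighted norm
  -- of `u = E w`. `P` is the Picard map in terms of `u`, and `Φ` is the same map in terms of `w`.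
  let E : (ℝ →ᵇ F) → ℝ → F := fun w s => Real.exp (lam * |s|) • w s
  have hEc : ∀ w, Continuous (E w) := fun w => by
    have := w.continuous
    fun_prop
  have hVE : ∀ w, Continuous (fun s => V (E w s)) := fun w => hV.continuous.comp (hEc w)
  have hEn : ∀ w s, ‖E w s‖ ≤ ‖w‖ * Real.exp (lam * |s|) := by
    intro w s
    rw [norm_smul, Real.norm_eq_abs, Real.abs_exp, mul_comm]
    gcongr
    exact w.norm_coe_le_norm s
  let P : (ℝ →ᵇ F) → ℝ → F := fun w t => x₀ + ∫ s in (0 : ℝ)..t, V (E w s)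
  have hPd : ∀ w t, HasDerivAt (P w) (V (E w t)) t := by
    intro w t
    exact (intervalIntegral.integral_hasDerivAt_right ((hVE w).intervalIntegrable _ _)
      ((hVE w).stronglyMeasurableAtFilter _ _) (hVE w).continuousAt).const_add x₀
  have hPc : ∀ w, Continuous (P w) := fun w =>
    continuous_iff_continuousAt.2 fun t => (hPd w t).continuousAt
  have hPb : ∀ w t, ‖P w t‖ ≤ (‖x₀‖ + (‖V 0‖ + K * ‖w‖) / lam) * Real.exp (lam * |t|) := by
    intro w t
    have h1 : ∀ s, 1 ≤ Real.exp (lam * |s|) := fun s => Real.one_le_exp (by positivity)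
    have h2 := norm_intervalIntegral_le_of_exp_bound (h := fun s => V (E w s)) hlam
      (C := ‖V 0‖ + K * ‖w‖) (by positivity) (fun s => by
        have ha := hVb (E w s)
        have hb := mul_le_mul_of_nonneg_left (hEn w s) K.coe_nonneg
        have hc := mul_le_mul_of_nonneg_left (h1 s) (norm_nonneg (V 0))
        nlinarith) t
    have h3 := norm_add_le x₀ (∫ s in (0 : ℝ)..t, V (E w s))
    have h4 := mul_le_mul_of_nonneg_left (h1 t) (norm_nonneg x₀)
    simp only [P]
    nlinarith
  have hexp : ∀ t, Real.exp (-(lam * |t|)) * Real.exp (lam * |t|) = 1 := fun t => by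
    rw [← Real.exp_add]; simp
  let Φ : (ℝ →ᵇ F) → (ℝ →ᵇ F) := fun w =>
    BoundedContinuousFunction.ofNormedAddCommGroup (fun t => Real.exp (-(lam * |t|)) • P w t)
      (by have := hPc w; fun_prop) (‖x₀‖ + (‖V 0‖ + K * ‖w‖) / lam) (fun t => by
        rw [norm_smul, Real.norm_eq_abs, Real.abs_exp]
        calc _ ≤ Real.exp (-(lam * |t|)) * ((‖x₀‖ + (‖V 0‖ + K * ‖w‖) / lam) *
              Real.exp (lam * |t|)) := by gcongr; exact hPb w t
          _ = _ := by rw [mul_left_comm, hexp, mul_one])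
  have hΦ : ContractingWith (K / (K + 1)) Φ := by
    refine ⟨(div_lt_one (by positivity)).2 (lt_add_one K), LipschitzWith.of_dist_le_mul ?_⟩
    intro w w'
    rw [BoundedContinuousFunction.dist_le (by positivity)]
    intro t
    have h1 : ‖P w t - P w' t‖ ≤ K * dist w w' / lam * Real.exp (lam * |t|) := by
      simp only [P, add_sub_add_left_eq_sub]
      rw [← intervalIntegral.integral_sub ((hVE w).intervalIntegrable _ _)
        ((hVE w').intervalIntegrable _ _)]
      refine norm_intervalIntegral_le_of_exp_bound hlam (by positivity) (fun s => ?_) t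
      rw [← dist_eq_norm]
      refine (hV.dist_le_mul _ _).trans ?_
      rw [mul_assoc]
      gcongr
      rw [dist_eq_norm, ← smul_sub, norm_smul, Real.norm_eq_abs, Real.abs_exp, mul_comm,
        ← dist_eq_norm]
      gcongr
      exact BoundedContinuousFunction.dist_coe_le_dist s
    change dist (Real.exp (-(lam * |t|)) • P w t) (Real.exp (-(lam * |t|)) • P w' t) ≤ _
    rw [dist_eq_norm, ← smul_sub, norm_smul, Real.norm_eq_abs, Real.abs_exp]
    calc _ ≤ Real.exp (-(lam * |t|)) * (K * dist w w' / lam * Real.exp (lam * |t|)) := by gcongr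
      _ = K * dist w w' / lam := by rw [mul_left_comm, hexp, mul_one]
      _ = _ := by rw [hlam_def]; push_cast; ring
  obtain ⟨w, hw, -⟩ := hΦ.exists_fixedPoint 0 (edist_ne_top _ _)
  have hwP : ∀ t, E w t = P w t := by
    intro t
    have h1 : w t = Real.exp (-(lam * |t|)) • P w t := by
      conv_lhs => rw [← hw]
      rfl
    simp only [E]
    rw [h1, smul_smul, mul_comm, hexp, one_smul]
  refine ⟨P w, by simp [P], fun t => ?_⟩
  rw [← hwP t]
  exact hPd w t

/-- Gronwall with `u i` as an exact trajectory of `V i` and `v` as an approximate one, whose error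
is the distance between `V i` and `V₀` along `v`. Uniform convergence of the fields is needed only
on the compact set `v '' Icc 0 R`. -/
lemma eventually_dist_lt_of_equiLipschitz_of_nonneg {ι : Type*} {l : Filter ι} {K : ℝ≥0}
    {V : ι → F → F} {V₀ : F → F} (hV : ∀ᶠ i in l, LipschitzWith K (V i))
    (hV₀ : LipschitzWith K V₀) (hlim : ∀ x, Tendsto (fun i => V i x) l (𝓝 (V₀ x)))
    {u : ι → ℝ → F} {v : ℝ → F} (hu : ∀ᶠ i in l, ∀ t, HasDerivAt (u i) (V i (u i t)) t)
    (hv : ∀ t, HasDerivAt v (V₀ (v t)) t) (h0 : ∀ᶠ i in l, u i 0 = v 0) (R : ℝ)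
    {ε : ℝ} (hε : 0 < ε) :
    ∀ᶠ i in l, ∀ t ∈ Set.Icc 0 R, dist (u i t) (v t) < ε := by
  have hvc : Continuous v := continuous_iff_continuousAt.2 fun t => (hv t).continuousAt
  -- The Gronwall bound with zero initial error is continuous in the field error and vanishes with
  -- it.
  obtain ⟨η, hη, hηε⟩ : ∃ η > 0, gronwallBound 0 K η R < ε := by
    have h1 := (gronwallBound_continuous_ε 0 K R).tendsto 0
    rw [gronwallBound_ε0_δ0] at h1
    have h2 : ∀ᶠ η in 𝓝[>] (0 : ℝ), gronwallBound 0 K η R < ε :=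
      (h1.mono_left nhdsWithin_le_nhds).eventually (gt_mem_nhds hε)
    obtain ⟨η, h3, h4⟩ := (h2.and self_mem_nhdsWithin).exists
    exact ⟨η, h4, h3⟩
  have h1 := eventually_forall_dist_le_of_equiLipschitz hV hV₀ hlim
    ((isCompact_Icc (a := (0 : ℝ)) (b := R)).image hvc) hη
  filter_upwards [hV, hu, h0, h1] with i hVi hui h0i h1i t ht
  have huc : Continuous (u i) := continuous_iff_continuousAt.2 fun t => (hui t).continuousAt
  have h2 := dist_le_of_approx_trajectories_ODE (v := fun _ => V i) (K := K) (εf := 0) (εg := η)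
    (δ := 0) (f := u i) (g := v) (a := 0) (b := R) (fun _ => hVi) huc.continuousOn
    (fun t _ => (hui t).hasDerivWithinAt) (fun t _ => by simp) hvc.continuousOn
    (fun t _ => (hv t).hasDerivWithinAt)
    (fun t ht => by
      rw [dist_comm]
      exact h1i _ (Set.mem_image_of_mem v (Set.Ico_subset_Icc_self ht)))
    (by simp [h0i]) t ht
  rw [zero_add, sub_zero] at h2
  exact (h2.trans (gronwallBound_mono le_rfl hη.le K.coe_nonneg ht.2)).trans_lt hηε

/-- Integral curves of equi-Lipschitz vector fields converging pointwise converge uniformly on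
bounded time intervals. -/
theorem tendstoUniformlyOn_of_equiLipschitz {ι : Type*} {l : Filter ι} {K : ℝ≥0}
    {V : ι → F → F} {V₀ : F → F} (hV : ∀ᶠ i in l, LipschitzWith K (V i))
    (hV₀ : LipschitzWith K V₀) (hlim : ∀ x, Tendsto (fun i => V i x) l (𝓝 (V₀ x)))
    {u : ι → ℝ → F} {v : ℝ → F} (hu : ∀ᶠ i in l, ∀ t, HasDerivAt (u i) (V i (u i t)) t)
    (hv : ∀ t, HasDerivAt v (V₀ (v t)) t) (h0 : ∀ᶠ i in l, u i 0 = v 0) (a b : ℝ) :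
    TendstoUniformlyOn u v l (Set.Icc a b) := by
  rw [Metric.tendstoUniformlyOn_iff]
  intro ε hε
  have hneg : ∀ (w : ℝ → F) (w' : F) (t : ℝ), HasDerivAt w w' (-t) →
      HasDerivAt (fun s => w (-s)) (-w') t := by
    intro w w' t hw
    simpa [Function.comp_def] using hw.scomp t (hasDerivAt_neg t)
  have h1 := eventually_dist_lt_of_equiLipschitz_of_nonneg hV hV₀ hlim hu hv h0 b hε
  -- Negative times: the reversed curves `t ↦ u i (-t)` are integral curves of `-V i`.
  have h2 := eventually_dist_lt_of_equiLipschitz_of_nonneg (K := K)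
    (V := fun i x => -V i x) (V₀ := fun x => -V₀ x) (u := fun i t => u i (-t))
    (v := fun t => v (-t)) (l := l)
    (hV.mono fun i hi => hi.neg) hV₀.neg (fun x => (hlim x).neg)
    (hu.mono fun i hi t => hneg _ _ t (hi (-t))) (fun t => hneg _ _ t (hv (-t)))
    (h0.mono fun i hi => by simpa using hi) (-a) hε
  filter_upwards [h1, h2] with i h1i h2i t ht
  rw [dist_comm]
  rcases le_total 0 t with h | h
  · exact h1i t ⟨h, ht.2⟩
  · simpa using h2i (-t) ⟨by linarith, by linarith [ht.1]⟩

end ODE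

/-! ### Integral operators and multiplication operators on `L²` -/

section Operators

variable {α : Type*} [MeasurableSpace α] {μ : Measure α}

/-- Cauchy–Schwarz for the splitting `k f = k^(1/2) · (k^(1/2) f)`. -/
lemma sq_lintegral_mul_le {k f : α → ℝ≥0∞} (hk : Measurable k) (hf : Measurable f) :
    (∫⁻ y, k y * f y ∂μ) ^ (2 : ℝ) ≤ (∫⁻ y, k y ∂μ) * ∫⁻ y, k y * f y ^ (2 : ℝ) ∂μ := by
  have h := ENNReal.lintegral_mul_le_Lp_mul_Lq μ (p := 2) (q := 2) Real.HolderConjugate.two_two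
    (f := fun y => k y ^ (1 / 2 : ℝ)) (g := fun y => k y ^ (1 / 2 : ℝ) * f y)
    (by fun_prop) (by fun_prop)
  have hs : ∀ y, (k y ^ (1 / 2 : ℝ)) ^ (2 : ℝ) = k y := fun y => by
    rw [← ENNReal.rpow_mul]; norm_num
  have e1 : ∀ y, ((fun y => k y ^ (1 / 2 : ℝ)) * fun y => k y ^ (1 / 2 : ℝ) * f y) y
      = k y * f y := fun y => by
    rw [Pi.mul_apply, ← mul_assoc, ← ENNReal.rpow_add_of_nonneg _ _ (by norm_num) (by norm_num)]
    norm_num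
  simp only [e1, hs, ENNReal.mul_rpow_of_nonneg _ _ (zero_le_two : (0 : ℝ) ≤ 2)] at h
  refine (ENNReal.rpow_le_rpow h zero_le_two).trans_eq ?_
  rw [ENNReal.mul_rpow_of_nonneg _ _ zero_le_two, ← ENNReal.rpow_mul, ← ENNReal.rpow_mul]
  norm_num

/-- Schur's test for non-negative functions. -/
lemma lintegral_sq_lintegral_mul_le [SFinite μ] {k : α → α → ℝ≥0∞}
    (hk : Measurable (Function.uncurry k)) {C : ℝ≥0∞} (hrow : ∀ x, ∫⁻ y, k x y ∂μ ≤ C)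
    (hcol : ∀ y, ∫⁻ x, k x y ∂μ ≤ C) {f : α → ℝ≥0∞} (hf : Measurable f) :
    ∫⁻ x, (∫⁻ y, k x y * f y ∂μ) ^ (2 : ℝ) ∂μ ≤ C ^ (2 : ℝ) * ∫⁻ y, f y ^ (2 : ℝ) ∂μ := by
  have hkx : ∀ x, Measurable (k x) := fun x => hk.comp measurable_prodMk_left
  have hky : ∀ y, Measurable (fun x => k x y) := fun y => hk.comp measurable_prodMk_right
  calc ∫⁻ x, (∫⁻ y, k x y * f y ∂μ) ^ (2 : ℝ) ∂μ
      ≤ ∫⁻ x, C * ∫⁻ y, k x y * f y ^ (2 : ℝ) ∂μ ∂μ := by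
        refine lintegral_mono fun x => (sq_lintegral_mul_le (hkx x) hf).trans ?_
        gcongr
        exact hrow x
    _ = C * ∫⁻ x, ∫⁻ y, k x y * f y ^ (2 : ℝ) ∂μ ∂μ := by
        rw [lintegral_const_mul]
        exact Measurable.lintegral_prod_right' (f := fun z : α × α => k z.1 z.2 * f z.2 ^ (2 : ℝ))
          (hk.mul ((hf.comp measurable_snd).pow_const _))
    _ = C * ∫⁻ y, ∫⁻ x, k x y * f y ^ (2 : ℝ) ∂μ ∂μ := by
        rw [lintegral_lintegral_swap]
        exact (hk.mul ((hf.comp measurable_snd).pow_const _)).aemeasurable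
    _ ≤ C * ∫⁻ y, C * f y ^ (2 : ℝ) ∂μ := by
        gcongr with y
        rw [lintegral_mul_const _ (hky y)]
        gcongr
        exact hcol y
    _ = C ^ (2 : ℝ) * ∫⁻ y, f y ^ (2 : ℝ) ∂μ := by
        rw [lintegral_const_mul _ (hf.pow_const _), ← mul_assoc]
        congr 1
        rw [← pow_two]
        norm_cast

lemma eLpNorm_two_rpow (f : α → ℝ) :
    eLpNorm f 2 μ ^ (2 : ℝ) = ∫⁻ x, ‖f x‖ₑ ^ (2 : ℝ) ∂μ := by
  simpa using eLpNorm_nnreal_pow_eq_lintegral (f := f) (μ := μ) (p := 2) two_ne_zero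

/-- **Schur's test**: a kernel with bounded row and column integrals defines a bounded operator
on `L²`. -/
theorem exists_integralOperator [SFinite μ] {k : α → α → ℝ}
    (hk : Measurable (Function.uncurry k)) {C : ℝ≥0} (hrow : ∀ x, ∫⁻ y, ‖k x y‖ₑ ∂μ ≤ C)
    (hcol : ∀ y, ∫⁻ x, ‖k x y‖ₑ ∂μ ≤ C) :
    ∃ T : Lp ℝ 2 μ →L[ℝ] Lp ℝ 2 μ, ‖T‖ ≤ C ∧
      ∀ f : Lp ℝ 2 μ, T f =ᵐ[μ] fun x => ∫ y, k x y * f y ∂μ := by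
  have hke : Measurable (Function.uncurry fun x y => ‖k x y‖ₑ) := hk.enorm
  have hsq : ∀ f : Lp ℝ 2 μ, ∫⁻ x, (∫⁻ y, ‖k x y‖ₑ * ‖f y‖ₑ ∂μ) ^ (2 : ℝ) ∂μ
      ≤ (C * eLpNorm f 2 μ) ^ (2 : ℝ) := by
    intro f
    rw [ENNReal.mul_rpow_of_nonneg _ _ zero_le_two, eLpNorm_two_rpow]
    exact lintegral_sq_lintegral_mul_le hke hrow hcol (Lp.stronglyMeasurable f).measurable.enorm
  have hmeas : ∀ f : Lp ℝ 2 μ, Measurable (Function.uncurry fun x y => k x y * f y) := fun f =>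
    hk.mul ((Lp.stronglyMeasurable f).measurable.comp measurable_snd)
  have hint : ∀ f : Lp ℝ 2 μ, ∀ᵐ x ∂μ, Integrable (fun y => k x y * f y) μ := by
    intro f
    have hm : Measurable (fun x => (∫⁻ y, ‖k x y‖ₑ * ‖f y‖ₑ ∂μ) ^ (2 : ℝ)) := by
      refine Measurable.pow_const ?_ _
      exact Measurable.lintegral_prod_right' (f := fun z : α × α => ‖k z.1 z.2‖ₑ * ‖f z.2‖ₑ)
        (hke.mul ((Lp.stronglyMeasurable f).measurable.comp measurable_snd).enorm)
    have h1 := ae_lt_top hm (ne_top_of_le_ne_top (ENNReal.rpow_ne_top_of_nonneg zero_le_two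
      (ENNReal.mul_ne_top ENNReal.coe_ne_top (Lp.eLpNorm_ne_top f))) (hsq f))
    filter_upwards [h1] with x hx
    refine ⟨((hmeas f).comp measurable_prodMk_left).aestronglyMeasurable, ?_⟩
    rw [hasFiniteIntegral_iff_enorm]
    simp only [enorm_mul]
    by_contra hcon
    rw [not_lt, top_le_iff] at hcon
    rw [hcon] at hx
    simp at hx
  have hsm : ∀ f : Lp ℝ 2 μ, StronglyMeasurable fun x => ∫ y, k x y * f y ∂μ := fun f =>
    StronglyMeasurable.integral_prod_right (hmeas f).stronglyMeasurable
  have hnorm : ∀ f : Lp ℝ 2 μ,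
      eLpNorm (fun x => ∫ y, k x y * f y ∂μ) 2 μ ≤ C * eLpNorm f 2 μ := by
    intro f
    rw [← ENNReal.rpow_le_rpow_iff (zero_lt_two : (0 : ℝ) < 2), eLpNorm_two_rpow]
    refine le_trans (lintegral_mono fun x => ?_) (hsq f)
    gcongr
    refine (enorm_integral_le_lintegral_enorm _).trans_eq ?_
    simp only [enorm_mul]
  have hLp : ∀ f : Lp ℝ 2 μ, MemLp (fun x => ∫ y, k x y * f y ∂μ) 2 μ := fun f =>
    ⟨(hsm f).aestronglyMeasurable, (hnorm f).trans_lt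
      (ENNReal.mul_lt_top ENNReal.coe_lt_top (Lp.eLpNorm_lt_top f))⟩
  let T₀ : Lp ℝ 2 μ →ₗ[ℝ] Lp ℝ 2 μ :=
    { toFun := fun f => (hLp f).toLp _
      map_add' := by
        intro f g
        rw [← MemLp.toLp_add]
        refine MemLp.toLp_congr _ _ ?_
        filter_upwards [hint f, hint g] with x hf hg
        rw [Pi.add_apply, ← integral_add hf hg]
        refine integral_congr_ae ?_
        filter_upwards [Lp.coeFn_add f g] with y hy
        rw [hy, Pi.add_apply, mul_add]
      map_smul' := by
        intro c f
        rw [RingHom.id_apply, ← MemLp.toLp_const_smul]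
        refine MemLp.toLp_congr _ _ (Eventually.of_forall fun x => ?_)
        rw [Pi.smul_apply, smul_eq_mul, ← integral_const_mul]
        refine integral_congr_ae ?_
        filter_upwards [Lp.coeFn_smul c f] with y hy
        rw [hy, Pi.smul_apply, smul_eq_mul]
        ring }
  have hT₀ : ∀ f, ‖T₀ f‖ ≤ C * ‖f‖ := by
    intro f
    change ‖(hLp f).toLp _‖ ≤ _
    rw [Lp.norm_toLp, Lp.norm_def, ← ENNReal.coe_toReal C, ← ENNReal.toReal_mul]
    exact ENNReal.toReal_mono
      (ENNReal.mul_ne_top ENNReal.coe_ne_top (Lp.eLpNorm_ne_top f)) (hnorm f)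
  exact ⟨T₀.mkContinuous C hT₀, LinearMap.mkContinuous_norm_le _ C.coe_nonneg _,
    fun f => (hLp f).coeFn_toLp⟩

/-- Multiplication by an essentially bounded function, as an operator on `L²`. -/
def mulOp {m : α → ℝ} (hm : MemLp m ∞ μ) : Lp ℝ 2 μ →L[ℝ] Lp ℝ 2 μ :=
  (ContinuousLinearMap.mul ℝ ℝ).holderL μ ∞ 2 2 (hm.toLp m)

lemma coeFn_mulOp {m : α → ℝ} (hm : MemLp m ∞ μ) (f : Lp ℝ 2 μ) :
    mulOp hm f =ᵐ[μ] fun x => m x * f x := by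
  have h := (ContinuousLinearMap.mul ℝ ℝ).coeFn_holder (r := 2) (hm.toLp m) f
  filter_upwards [h, hm.coeFn_toLp] with x h1 h2
  rw [← h2]
  exact h1

end Operators

/-! ### The weighted averaging operators -/

section Averages

variable {N : ℕ} {Ω : Set (E N)} {X : E N → ℝ}

lemma IsDensity.nonneg (hX : IsDensity Ω X) (x : E N) : 0 ≤ X x := by
  obtain ⟨c, hc, h⟩ := hX.bounded_below
  by_cases hx : x ∈ Ω
  · exact hc.le.trans (h x hx)
  · exact (hX.eq_zero x hx).ge

lemma IsDensity.pos (hX : IsDensity Ω X) {x : E N} (hx : x ∈ Ω) : 0 < X x := by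
  obtain ⟨c, hc, h⟩ := hX.bounded_below
  exact hc.trans_le (h x hx)

lemma IsDensity.measurable (hX : IsDensity Ω X) (hΩ : IsOpen Ω) (hXc : ContinuousOn X Ω) :
    Measurable X := by
  classical
  have h : Ω.piecewise X 0 = X := by
    ext x
    by_cases hx : x ∈ Ω
    · simp [hx]
    · simp [hx, hX.eq_zero x hx]
  rw [← h]
  exact hXc.measurable_piecewise continuousOn_const hΩ.measurableSet

lemma IsDensity.memLp (hX : IsDensity Ω X) (hΩ : IsOpen Ω) (hΩb : Bornology.IsBounded Ω)
    (p : ℝ≥0∞) : MemLp X p := by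
  have : IsFiniteMeasure ((volume : Measure (E N)).restrict Ω) :=
    isFiniteMeasure_restrict.2 hΩb.measure_lt_top.ne
  have h1 : MemLp X p ((volume : Measure (E N)).restrict Ω) :=
    (hX.memLp_top.restrict Ω).mono_exponent le_top
  rw [← memLp_indicator_iff_restrict hΩ.measurableSet] at h1
  rwa [Set.indicator_eq_self.2 fun x hx => by_contra fun h => hx (hX.eq_zero x h)] at h1

lemma IsDensity.integrable (hX : IsDensity Ω X) (hΩ : IsOpen Ω) (hΩb : Bornology.IsBounded Ω) :
    Integrable X := memLp_one_iff_integrable.1 (hX.memLp hΩ hΩb 1)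

lemma measurable_integral_ball {f : E N → ℝ} (hf : Measurable f) (δ : ℝ) :
    Measurable fun x => ∫ y in Metric.ball x δ, f y := by
  have h1 : ∀ x, ∫ y in Metric.ball x δ, f y
      = ∫ y, {p : E N × E N | dist p.2 p.1 < δ}.indicator (fun p => f p.2) (x, y) := by
    intro x
    rw [← integral_indicator measurableSet_ball]
    rfl
  simp_rw [h1]
  have hs : MeasurableSet {p : E N × E N | dist p.2 p.1 < δ} :=
    (isOpen_lt (by fun_prop) (by fun_prop)).measurableSet
  exact ((StronglyMeasurable.integral_prod_right
    (f := fun x y => {p : E N × E N | dist p.2 p.1 < δ}.indicator (fun p => f p.2) (x, y))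
    (((hf.comp measurable_snd).indicator hs).stronglyMeasurable))).measurable

/-- Balls of radius `δ` are covered by a number of balls of radius `δ / 2` independent of `δ`. -/
lemma exists_finset_ball_subset_biUnion (N : ℕ) :
    ∃ S : Finset (E N), ∀ (δ : ℝ) (y : E N),
      Metric.ball y δ ⊆ ⋃ z ∈ S, Metric.ball (y + δ • z) (δ / 2) := by
  obtain ⟨T, -, hTf, hT⟩ := (isCompact_closedBall (0 : E N) 1).finite_cover_balls
    (half_pos (zero_lt_one (α := ℝ)))
  refine ⟨hTf.toFinset, fun δ y x hx => ?_⟩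
  have hδ : 0 < δ := dist_nonneg.trans_lt (Metric.mem_ball.1 hx)
  have h1 : δ⁻¹ • (x - y) ∈ Metric.closedBall (0 : E N) 1 := by
    rw [mem_closedBall_zero_iff, norm_smul, norm_inv, Real.norm_of_nonneg hδ.le,
      inv_mul_le_one₀ hδ, ← dist_eq_norm]
    exact (Metric.mem_ball.1 hx).le
  obtain ⟨z, hz, hxz⟩ := Set.mem_iUnion₂.1 (hT h1)
  refine Set.mem_iUnion₂.2 ⟨z, by simpa using hz, ?_⟩
  rw [Metric.mem_ball, dist_eq_norm] at hxz ⊢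
  have h2 : x - (y + δ • z) = δ • (δ⁻¹ • (x - y) - z) := by
    rw [smul_sub, smul_smul, mul_inv_cancel₀ hδ.ne', one_smul]
    abel
  rw [h2, norm_smul, Real.norm_of_nonneg hδ.le]
  linarith [mul_lt_mul_of_pos_left hxz hδ]

lemma ofReal_mul_volume_le (hX : IsDensity Ω X) (hΩ : IsOpen Ω) (hΩb : Bornology.IsBounded Ω)
    {c : ℝ} (hc : ∀ x ∈ Ω, c ≤ X x) (x : E N) (δ : ℝ) :
    ENNReal.ofReal c * volume (Metric.ball x δ ∩ Ω) ≤
      ENNReal.ofReal (∫ y in Metric.ball x δ, X y) := by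
  rw [ofReal_integral_eq_lintegral_ofReal (hX.integrable hΩ hΩb).integrableOn
    (Eventually.of_forall fun y => hX.nonneg y)]
  calc ENNReal.ofReal c * volume (Metric.ball x δ ∩ Ω)
      = ∫⁻ _ in Metric.ball x δ ∩ Ω, ENNReal.ofReal c := by rw [setLIntegral_const]
    _ ≤ ∫⁻ y in Metric.ball x δ ∩ Ω, ENNReal.ofReal (X y) :=
        setLIntegral_mono' (measurableSet_ball.inter hΩ.measurableSet)
          fun y hy => ENNReal.ofReal_le_ofReal (hc y hy.2)
    _ ≤ _ := lintegral_mono_set Set.inter_subset_left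

lemma enorm_inv_integral_le (hX : IsDensity Ω X) (hΩ : IsOpen Ω) (hΩb : Bornology.IsBounded Ω)
    {c : ℝ} (hc : ∀ x ∈ Ω, c ≤ X x) (x : E N) (δ : ℝ) :
    ‖(∫ y in Metric.ball x δ, X y)⁻¹‖ₑ ≤
      (ENNReal.ofReal c * volume (Metric.ball x δ ∩ Ω))⁻¹ := by
  by_cases h : ∫ y in Metric.ball x δ, X y = 0
  · simp [h]
  · rw [enorm_inv h, ENNReal.inv_le_inv,
      Real.enorm_of_nonneg (integral_nonneg fun y => hX.nonneg y)]
    exact ofReal_mul_volume_le hX hΩ hΩb hc x δ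

/-- Only an inequality, so that `b = 0` and `b = ∞` need no separate treatment; `b` will be the
volume of a piece of `Ω`, possibly null. -/
lemma inv_mul_self_mul_le (a b : ℝ≥0∞) (ha : a ≠ 0) (ha' : a ≠ ∞) : (a * b)⁻¹ * b ≤ a⁻¹ := by
  rw [ENNReal.mul_inv (.inl ha) (.inl ha'), mul_assoc]
  exact mul_le_of_le_one_right' (ENNReal.inv_mul_le_one b)

/-- The averages `m_X` define operators on `L²` that are bounded uniformly in the radius. -/
theorem exists_meanOperator (hX : IsDensity Ω X) (hΩ : IsOpen Ω)
    (hΩb : Bornology.IsBounded Ω) (hXc : ContinuousOn X Ω) :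
    ∃ (C : ℝ≥0) (M : ℝ → L2 N →L[ℝ] L2 N), (∀ δ, ‖M δ‖ ≤ C) ∧
      ∀ δ (f : L2 N), M δ f =ᵐ[volume] Ω.indicator (mean X δ (Ω.indicator f)) := by
  obtain ⟨c, hc0, hc⟩ := hX.bounded_below
  obtain ⟨S, hS⟩ := exists_finset_ball_subset_biUnion N
  have hXm := hX.measurable hΩ hXc
  have hc0' : ENNReal.ofReal c ≠ 0 := by simpa using hc0
  -- The columns cost `S.card / c` and the rows `1 / c`; the sum bounds both.
  set C : ℝ≥0 := (S.card + 1) * c.toNNReal⁻¹ with hC_def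
  have hC : (C : ℝ≥0∞) = (S.card + 1) * (ENNReal.ofReal c)⁻¹ := by
    rw [hC_def, ENNReal.coe_mul, ENNReal.coe_inv (by simpa using hc0)]
    push_cast
    rfl
  have hop : ∀ δ : ℝ, ∃ T : L2 N →L[ℝ] L2 N, ‖T‖ ≤ C ∧
      ∀ f : L2 N, T f =ᵐ[volume] Ω.indicator (mean X δ (Ω.indicator f)) := by
    intro δ
    set A : Set (E N × E N) := {p | p.1 ∈ Ω ∧ p.2 ∈ Ω ∧ dist p.2 p.1 < δ} with hA_def
    have hlt : MeasurableSet {p : E N × E N | dist p.2 p.1 < δ} :=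
      (isOpen_lt (by fun_prop) (by fun_prop)).measurableSet
    have hA : MeasurableSet A :=
      (measurable_fst hΩ.measurableSet).inter ((measurable_snd hΩ.measurableSet).inter hlt)
    let k : E N → E N → ℝ := fun x y =>
      A.indicator (fun p => (∫ y in Metric.ball p.1 δ, X y)⁻¹) (x, y)
    have hk : Measurable (Function.uncurry k) :=
      ((measurable_integral_ball hXm δ).comp measurable_fst).inv.indicator hA
    have hke : ∀ x y, ‖k x y‖ₑ =
        A.indicator (fun p => ‖(∫ y in Metric.ball p.1 δ, X y)⁻¹‖ₑ) (x, y) := by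
      intro x y
      exact enorm_indicator_eq_indicator_enorm _ _
    have hrow : ∀ x, ∫⁻ y, ‖k x y‖ₑ ≤ C := by
      intro x
      calc ∫⁻ y, ‖k x y‖ₑ
          ≤ ∫⁻ y, (Metric.ball x δ ∩ Ω).indicator
              (fun _ => ‖(∫ y in Metric.ball x δ, X y)⁻¹‖ₑ) y := by
            refine lintegral_mono fun y => ?_
            simp only [hke]
            by_cases hxy : (x, y) ∈ A
            · have hy : y ∈ Metric.ball x δ ∩ Ω := ⟨hxy.2.2, hxy.2.1⟩
              rw [Set.indicator_of_mem hxy, Set.indicator_of_mem hy]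
            · rw [Set.indicator_of_notMem hxy]
              exact zero_le
        _ = ‖(∫ y in Metric.ball x δ, X y)⁻¹‖ₑ * volume (Metric.ball x δ ∩ Ω) := by
            rw [lintegral_indicator (measurableSet_ball.inter hΩ.measurableSet), setLIntegral_const]
        _ ≤ (ENNReal.ofReal c)⁻¹ := by
            refine le_trans ?_ (inv_mul_self_mul_le _ (volume (Metric.ball x δ ∩ Ω)) hc0'
              ENNReal.ofReal_ne_top)
            gcongr
            exact enorm_inv_integral_le hX hΩ hΩb hc x δ
        _ ≤ C := by
            rw [hC]
            exact le_mul_of_one_le_left' le_add_self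
    -- The volume of `ball x δ ∩ Ω` may degenerate near `∂Ω`, so no pointwise bound on the kernel is
    -- available. Instead `ball y δ` is cut into pieces `B z` of radius `δ / 2`: for `x ∈ B z` all
    -- of `B z` lies in `ball x δ ∩ Ω`, so the kernel is at most `1 / (c |B z|)` there and each
    -- piece contributes at most `1 / c`.
    have hcol : ∀ y, ∫⁻ x, ‖k x y‖ₑ ≤ C := by
      intro y
      let q : E N → ℝ≥0∞ := fun x => ‖(∫ y in Metric.ball x δ, X y)⁻¹‖ₑ
      let B : E N → Set (E N) := fun z => Metric.ball (y + δ • z) (δ / 2) ∩ Ω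
      have hB : ∀ z, MeasurableSet (B z) := fun z => measurableSet_ball.inter hΩ.measurableSet
      have hBint : ∀ z, ∫⁻ x in B z, q x ≤ (ENNReal.ofReal c)⁻¹ := by
        intro z
        calc ∫⁻ x in B z, q x
            ≤ ∫⁻ x in B z, (ENNReal.ofReal c * volume (B z))⁻¹ := by
              refine setLIntegral_mono' (hB z) fun x hx => ?_
              refine (enorm_inv_integral_le hX hΩ hΩb hc x δ).trans ?_
              refine ENNReal.inv_le_inv.2 (mul_le_mul_right (measure_mono ?_) _)
              refine Set.inter_subset_inter_left _ (Metric.ball_subset_ball' ?_)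
              have := hx.1
              rw [Metric.mem_ball, dist_comm] at this
              linarith
          _ = (ENNReal.ofReal c * volume (B z))⁻¹ * volume (B z) := setLIntegral_const _ _
          _ ≤ _ := inv_mul_self_mul_le _ _ hc0' ENNReal.ofReal_ne_top
      calc ∫⁻ x, ‖k x y‖ₑ
          ≤ ∫⁻ x, ∑ z ∈ S, (B z).indicator q x := by
            refine lintegral_mono fun x => ?_
            simp only [hke]
            by_cases hxy : (x, y) ∈ A
            · rw [Set.indicator_of_mem hxy]
              obtain ⟨z, hz, hxz⟩ := Set.mem_iUnion₂.1
                (hS δ y (by rw [Metric.mem_ball, dist_comm]; exact hxy.2.2))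
              have hxB : x ∈ B z := ⟨hxz, hxy.1⟩
              calc q x = (B z).indicator q x := (Set.indicator_of_mem hxB q).symm
                _ ≤ _ := Finset.single_le_sum (f := fun z => (B z).indicator q x)
                    (fun _ _ => zero_le) hz
            · rw [Set.indicator_of_notMem hxy]
              exact zero_le
        _ = ∑ z ∈ S, ∫⁻ x, (B z).indicator q x := by
            refine lintegral_finsetSum _ fun z _ => ?_
            exact (measurable_integral_ball hXm δ).inv.enorm.indicator (hB z)
        _ ≤ ∑ z ∈ S, (ENNReal.ofReal c)⁻¹ := by
            refine Finset.sum_le_sum fun z _ => ?_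
            rw [lintegral_indicator (hB z)]
            exact hBint z
        _ ≤ C := by
            rw [hC, Finset.sum_const, nsmul_eq_mul]
            gcongr
            exact le_self_add
    obtain ⟨T, hT, hTf⟩ := exists_integralOperator hk hrow hcol
    refine ⟨T, hT, fun f => (hTf f).trans (Eventually.of_forall fun x => ?_)⟩
    by_cases hx : x ∈ Ω
    · rw [Set.indicator_of_mem hx, mean, ← integral_const_mul,
        ← integral_indicator measurableSet_ball]
      refine integral_congr_ae (Eventually.of_forall fun y => ?_)
      by_cases hy : y ∈ Ω <;> by_cases hxy : dist y x < δ <;>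
        simp [k, hA_def, Set.indicator, hx, hy, hxy]
    · simp [k, hA_def, Set.indicator, hx]
  choose M hM hMf using hop
  exact ⟨C, M, hM, hMf⟩

/-- On `Ω` one has `|f| ≤ B ≤ (B / c) X`, so the numerator is at most `B / c` times the denominator.
The bound is uniform in `δ` and supplies the dominating function for the convergence of the
averages. -/
lemma abs_mean_le (hX : IsDensity Ω X) (hΩ : IsOpen Ω) (hΩb : Bornology.IsBounded Ω)
    {c : ℝ} (hc0 : 0 < c) (hc : ∀ x ∈ Ω, c ≤ X x) {f : E N → ℝ} {B : ℝ} (hB : ∀ x, |f x| ≤ B)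
    (δ : ℝ) (x : E N) : |mean X δ (Ω.indicator f) x| ≤ B / c := by
  have hB0 : 0 ≤ B := (abs_nonneg _).trans (hB 0)
  set a := ∫ y in Metric.ball x δ, X y with ha_def
  have ha : 0 ≤ a := integral_nonneg fun y => hX.nonneg y
  have h1 : |∫ y in Metric.ball x δ, Ω.indicator f y| ≤ B / c * a := by
    rw [ha_def, ← integral_const_mul, ← Real.norm_eq_abs]
    refine norm_integral_le_of_norm_le
      (((hX.integrable hΩ hΩb).const_mul _).integrableOn) (Eventually.of_forall fun y => ?_)
    by_cases hy : y ∈ Ω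
    · rw [Set.indicator_of_mem hy, Real.norm_eq_abs]
      calc |f y| ≤ B := hB y
        _ = B / c * c := by field_simp
        _ ≤ _ := by gcongr; exact hc y hy
    · simp [hy, hX.eq_zero y hy]
  rw [mean, abs_mul, abs_inv, abs_of_nonneg ha]
  rcases ha.eq_or_lt with h | h
  · rw [← h]
    simp
    positivity
  · rw [inv_mul_le_iff₀ h, mul_comm a]
    exact h1

/-- Dividing numerator and denominator by the volume of the ball leaves two plain averages, of
functions continuous at the interior point `x`. -/
lemma tendsto_mean (hX : IsDensity Ω X) (hΩ : IsOpen Ω) (hXc : ContinuousOn X Ω)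
    {f : E N → ℝ} (hf : Continuous f) {x : E N} (hx : x ∈ Ω) :
    Tendsto (fun δ => mean X δ (Ω.indicator f) x) (𝓝[>] 0) (𝓝 ((X x)⁻¹ * f x)) := by
  have hΩx : Ω ∈ 𝓝 x := hΩ.mem_nhds hx
  have hs : Tendsto (Metric.ball x) (𝓝[>] (0 : ℝ)) (𝓝 x).smallSets := by
    rw [Metric.nhds_basis_ball.smallSets.tendsto_right_iff]
    intro ε hε
    filter_upwards [Ioo_mem_nhdsGT hε] with δ hδ
    exact Metric.ball_subset_ball hδ.2.le
  have hpos : ∀ᶠ δ in 𝓝[>] (0 : ℝ), 0 < volume.real (Metric.ball x δ) := by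
    filter_upwards [self_mem_nhdsWithin] with δ hδ
    exact ENNReal.toReal_pos (Metric.measure_ball_pos volume x hδ).ne' measure_ball_lt_top.ne
  have key : ∀ φ : E N → ℝ, Measurable φ → ContinuousAt φ x →
      Tendsto (fun δ => (volume.real (Metric.ball x δ))⁻¹ * ∫ y in Metric.ball x δ, φ y)
        (𝓝[>] 0) (𝓝 (φ x)) := by
    intro φ hφm hφ
    have h1 := (hφ.integral_sub_linear_isLittleO_ae (μ := volume)
      (hφm.stronglyMeasurable.stronglyMeasurableAtFilter) hs).tendsto_div_nhds_zero
    have h2 := h1.add_const (φ x)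
    rw [zero_add] at h2
    refine h2.congr' ?_
    filter_upwards [hpos] with δ hδ
    rw [smul_eq_mul]
    field_simp
    ring
  have hXm := hX.measurable hΩ hXc
  have h1 := key X hXm (hXc.continuousAt hΩx)
  have h2 := key (Ω.indicator f) (hf.measurable.indicator hΩ.measurableSet) (by
    refine hf.continuousAt.congr ?_
    filter_upwards [hΩx] with y hy
    rw [Set.indicator_of_mem hy])
  have h3 := (h1.inv₀ (hX.pos hx).ne').mul h2
  rw [Set.indicator_of_mem hx] at h3
  refine h3.congr' ?_
  filter_upwards [hpos] with δ hδ
  rw [mean, mul_inv, inv_inv]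
  field_simp

lemma memLp_inv_density (hX : IsDensity Ω X) (hΩ : IsOpen Ω) (hXc : ContinuousOn X Ω) :
    MemLp (fun x => (X x)⁻¹) ∞ (volume : Measure (E N)) := by
  obtain ⟨c, hc0, hc⟩ := hX.bounded_below
  refine memLp_top_of_bound (hX.measurable hΩ hXc).inv.aestronglyMeasurable c⁻¹
    (Eventually.of_forall fun x => ?_)
  rw [norm_inv, Real.norm_of_nonneg (hX.nonneg x)]
  by_cases hx : x ∈ Ω
  · exact inv_anti₀ hc0 (hc x hx)
  · rw [hX.eq_zero x hx, inv_zero]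
    positivity

/-- The averages converge strongly in `L²` to the quotient by the density. -/
theorem tendsto_meanOperator (hX : IsDensity Ω X) (hΩ : IsOpen Ω)
    (hΩb : Bornology.IsBounded Ω) (hXc : ContinuousOn X Ω) {C : ℝ≥0}
    {M : ℝ → L2 N →L[ℝ] L2 N} (hM : ∀ δ, ‖M δ‖ ≤ C)
    (hMf : ∀ δ (f : L2 N), M δ f =ᵐ[volume] Ω.indicator (mean X δ (Ω.indicator f)))
    (f : L2 N) :
    Tendsto (fun δ => M δ f) (𝓝[>] 0) (𝓝 (mulOp (memLp_inv_density hX hΩ hXc) f)) := by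
  obtain ⟨c, hc0, hc⟩ := hX.bounded_below
  set Q := mulOp (memLp_inv_density hX hΩ hXc) with hQ_def
  -- The uniform operator bound makes the set of `f` with convergence closed, so continuous
  -- compactly supported functions suffice; for these, dominated convergence on the bounded set `Ω`
  -- applies.
  have hequi : Equicontinuous fun (δ : ℝ) (f : L2 N) => M δ f :=
    (LipschitzWith.uniformEquicontinuous _ C fun δ =>
      (M δ).lipschitz.weaken (by exact_mod_cast hM δ)).equicontinuous
  have hclosed : IsClosed {f : L2 N | Tendsto (fun δ => M δ f) (𝓝[>] 0) (𝓝 (Q f))} :=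
    hequi.isClosed_setOfPred_tendsto Q.continuous
  have hcont : ∀ (φ : E N → ℝ) (hφ : MemLp φ 2 (volume : Measure (E N))), Continuous φ →
      HasCompactSupport φ → Tendsto (fun δ => M δ (hφ.toLp φ)) (𝓝[>] 0) (𝓝 (Q (hφ.toLp φ))) := by
    intro φ hφ hφc hφs
    obtain ⟨B, hB⟩ := hφs.exists_bound_of_continuous hφc
    simp only [Real.norm_eq_abs] at hB
    have hB0 : 0 ≤ B := (abs_nonneg _).trans (hB 0)
    let d : ℝ → E N → ℝ := fun δ =>
      Ω.indicator fun x => mean X δ (Ω.indicator φ) x - (X x)⁻¹ * φ x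
    have hd : ∀ δ, ⇑(M δ (hφ.toLp φ)) - ⇑(Q (hφ.toLp φ)) =ᵐ[volume] d δ := by
      intro δ
      have hmean : ∀ x, mean X δ (Ω.indicator (hφ.toLp φ)) x = mean X δ (Ω.indicator φ) x := by
        intro x
        unfold mean
        congr 1
        refine integral_congr_ae (ae_restrict_of_ae ?_)
        filter_upwards [hφ.coeFn_toLp] with y hy
        simp only [Set.indicator, hy]
      filter_upwards [hMf δ (hφ.toLp φ), coeFn_mulOp (memLp_inv_density hX hΩ hXc) (hφ.toLp φ),
        hφ.coeFn_toLp] with x h1 h2 h3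
      rw [Pi.sub_apply, h1, h2, h3]
      by_cases hx : x ∈ Ω
      · simp only [d, Set.indicator_of_mem hx, hmean]
      · simp [d, hx, hX.eq_zero x hx]
    rw [Lp.tendsto_Lp_iff_tendsto_eLpNorm']
    have h1 : Tendsto (fun δ => ∫⁻ x, ‖d δ x‖ₑ ^ (2 : ℝ)) (𝓝[>] 0) (𝓝 (∫⁻ _ : E N, 0)) := by
      refine tendsto_lintegral_filter_of_dominated_convergence'
        (Ω.indicator fun _ => ENNReal.ofReal (B / c + c⁻¹ * B) ^ (2 : ℝ)) ?_ ?_ ?_ ?_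
      · refine Eventually.of_forall fun δ => ?_
        exact ((((Lp.aestronglyMeasurable _).sub (Lp.aestronglyMeasurable _)).congr
          (hd δ)).enorm).pow_const _
      · refine Eventually.of_forall fun δ => Eventually.of_forall fun x => ?_
        by_cases hx : x ∈ Ω
        · simp only [d, Set.indicator_of_mem hx]
          gcongr
          rw [Real.enorm_eq_ofReal_abs]
          refine ENNReal.ofReal_le_ofReal ((abs_sub _ _).trans ?_)
          refine add_le_add (abs_mean_le hX hΩ hΩb hc0 hc hB δ x) ?_
          rw [abs_mul, abs_inv, abs_of_pos (hX.pos hx)]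
          gcongr
          · exact hc x hx
          · exact hB x
        · simp [d, hx]
      · rw [lintegral_indicator hΩ.measurableSet, setLIntegral_const]
        exact ENNReal.mul_ne_top (ENNReal.rpow_ne_top_of_nonneg zero_le_two ENNReal.ofReal_ne_top)
          hΩb.measure_lt_top.ne
      · refine Eventually.of_forall fun x => ?_
        by_cases hx : x ∈ Ω
        · simp only [d, Set.indicator_of_mem hx]
          have h2 := ((tendsto_mean hX hΩ hXc hφc hx).sub_const ((X x)⁻¹ * φ x)).enorm
          rw [sub_self, enorm_zero] at h2
          simpa [Function.comp_def] using (ENNReal.continuous_rpow_const (y := 2)).tendsto _ |>.comp h2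
        · simp [d, hx]
    rw [lintegral_zero] at h1
    have h2 := ((ENNReal.continuous_rpow_const (y := 1 / 2)).tendsto _).comp h1
    rw [ENNReal.zero_rpow_of_pos (by norm_num)] at h2
    refine h2.congr fun δ => ?_
    rw [Function.comp_apply, ← eLpNorm_two_rpow, ← ENNReal.rpow_mul, eLpNorm_congr_ae (hd δ)]
    norm_num
  have hmem : f ∈ closure {f : L2 N | Tendsto (fun δ => M δ f) (𝓝[>] 0) (𝓝 (Q f))} := by
    rw [Metric.mem_closure_iff]
    intro ε hε
    obtain ⟨φ, hφs, hφe, hφc, hφ⟩ := (Lp.memLp f).exists_hasCompactSupport_eLpNorm_sub_le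
      ENNReal.ofNat_ne_top (ε := ENNReal.ofReal (ε / 2)) (by simpa using hε)
    refine ⟨hφ.toLp φ, hcont φ hφ hφc hφs, ?_⟩
    rw [Lp.dist_def, eLpNorm_congr_ae (EventuallyEq.rfl.sub hφ.coeFn_toLp)]
    refine (ENNReal.toReal_le_of_le_ofReal (by positivity) hφe).trans_lt (by linarith)
  rwa [hclosed.closure_eq] at hmem

end Averages

/-! ### The evolution problems as ordinary differential equations in `L²` -/

section Evolution

variable {N : ℕ} {Ω : Set (E N)} {J X u₀ h₀ : E N → ℝ} {g : ℝ → ℝ} {L : ℝ≥0}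

/-- Convolution with a kernel, as an operator on `L²`. -/
theorem IsKernel.exists_convolutionOperator (hJ : IsKernel J) :
    ∃ T : L2 N →L[ℝ] L2 N, ∀ f : L2 N, T f =ᵐ[volume] fun x => ∫ y, J (x - y) * f y := by
  have hint : ∫⁻ y, ‖J y‖ₑ = 1 := by
    have h := ofReal_integral_norm_eq_lintegral_enorm hJ.integrable
    simp_rw [Real.norm_of_nonneg (hJ.nonneg _), hJ.integral_eq_one] at h
    rw [← h, ENNReal.ofReal_one]
  have hk : Measurable (Function.uncurry fun x y => J (x - y)) :=
    (hJ.continuous.comp (continuous_fst.sub continuous_snd)).measurable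
  obtain ⟨T, -, hT⟩ := exists_integralOperator (μ := volume) (C := 1) hk
    (fun x => by
      rw [lintegral_sub_left_eq_self (fun y => ‖J y‖ₑ) x, hint, ENNReal.coe_one])
    (fun y => by
      rw [lintegral_sub_right_eq_self (fun x => ‖J x‖ₑ) y, hint, ENNReal.coe_one])
  exact ⟨T, hT⟩

/-- The convolution of a kernel with a bounded function is bounded. -/
lemma IsKernel.memLp_top_convolution (hJ : IsKernel J) {w : E N → ℝ} (hwm : Measurable w)
    (hw : MemLp w ∞ (volume : Measure (E N))) :
    MemLp (fun x => ∫ y, J (x - y) * w y) ∞ (volume : Measure (E N)) := by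
  obtain ⟨W, hW⟩ : ∃ W : ℝ, ∀ᵐ y, ‖w y‖ ≤ W := by
    refine ⟨(eLpNormEssSup w volume).toReal, ?_⟩
    filter_upwards [enorm_ae_le_eLpNormEssSup w volume] with y hy
    rw [← toReal_enorm]
    refine ENNReal.toReal_mono ?_ hy
    rw [← eLpNorm_exponent_top]
    exact hw.2.ne
  have hm : Measurable (Function.uncurry fun x y => J (x - y) * w y) :=
    (hJ.continuous.comp (continuous_fst.sub continuous_snd)).measurable.mul
      (hwm.comp measurable_snd)
  refine memLp_top_of_bound
    (StronglyMeasurable.integral_prod_right hm.stronglyMeasurable).aestronglyMeasurable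
    W (Eventually.of_forall fun x => ?_)
  have h1 : ‖∫ y, J (x - y) * w y‖ ≤ ∫ y, J (x - y) * W := by
    refine norm_integral_le_of_norm_le ((hJ.integrable.comp_sub_left x).mul_const _) ?_
    filter_upwards [hW] with y hy
    rw [norm_mul, Real.norm_of_nonneg (hJ.nonneg _)]
    exact mul_le_mul_of_nonneg_left hy (hJ.nonneg _)
  rwa [integral_mul_const, integral_sub_left_eq_self J volume x, hJ.integral_eq_one, one_mul] at h1

lemma memLp_hNeumann (hΩ : IsOpen Ω) (hJ : IsKernel J) (hX : IsDensity Ω X)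
    (hXm : Measurable X) : MemLp (hNeumann Ω J X) ∞ (volume : Measure (E N)) :=
  hJ.memLp_top_convolution
    ((measurable_const.sub (measurable_const.indicator hΩ.measurableSet)).add hXm)
    (((memLp_top_const (1 : ℝ)).sub
      ((memLp_top_const (1 : ℝ)).indicator hΩ.measurableSet)).add hX.memLp_top)

/-- Composition preserves `L²(ℝ^N)` for a Lipschitz function vanishing at `0`. The constant `g 0` is
put back as `g 0 • X`, which lies in `L²`. -/
lemma lipschitzWith_sub_apply_zero (hg : LipschitzWith L g) :
    LipschitzWith L fun s => g s - g 0 :=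
  LipschitzWith.of_dist_le_mul fun a b => by
    rw [dist_sub_right]
    exact hg.dist_le_mul a b

/-- The vector field `u ↦ X (T u) - h u + X g(B u)` on `L²(ℝ^N)`. -/
def vectorField {X h : E N → ℝ} (hX : MemLp X ∞ (volume : Measure (E N)))
    (hX₂ : MemLp X 2 (volume : Measure (E N))) (hh : MemLp h ∞ (volume : Measure (E N)))
    (hg : LipschitzWith L g) (T B : L2 N →L[ℝ] L2 N) (u : L2 N) : L2 N :=
  mulOp hX (T u) - mulOp hh u +
    (mulOp hX ((lipschitzWith_sub_apply_zero hg).compLp (sub_self _) (B u)) + g 0 • hX₂.toLp X)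

section VectorField

variable {h : E N → ℝ} (hX : MemLp X ∞ (volume : Measure (E N)))
    (hX₂ : MemLp X 2 (volume : Measure (E N))) (hh : MemLp h ∞ (volume : Measure (E N)))
    (hg : LipschitzWith L g) (T : L2 N →L[ℝ] L2 N)

lemma coeFn_vectorField (B : L2 N →L[ℝ] L2 N) (u : L2 N) :
    vectorField hX hX₂ hh hg T B u =ᵐ[volume]
      fun x => X x * T u x - h x * u x + X x * g (B u x) := by
  set w := (lipschitzWith_sub_apply_zero hg).compLp (sub_self _) (B u) with hw
  unfold vectorField
  filter_upwards [Lp.coeFn_add (mulOp hX (T u) - mulOp hh u) (mulOp hX w + g 0 • hX₂.toLp X),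
    Lp.coeFn_sub (mulOp hX (T u)) (mulOp hh u), Lp.coeFn_add (mulOp hX w) (g 0 • hX₂.toLp X),
    Lp.coeFn_smul (g 0) (hX₂.toLp X), hX₂.coeFn_toLp, coeFn_mulOp hX (T u), coeFn_mulOp hh u,
    coeFn_mulOp hX w, (lipschitzWith_sub_apply_zero hg).coeFn_compLp (sub_self _) (B u)]
    with x h1 h2 h3 h4 h5 h6 h7 h8 h9
  rw [h1, Pi.add_apply, h2, h3, Pi.sub_apply, Pi.add_apply, h4, Pi.smul_apply, h5, h6, h7, h8, h9,
    Function.comp_apply, smul_eq_mul]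
  ring

/-- The constant sees `B` only through the bound `C`, so one constant serves all radii. -/
lemma lipschitzWith_vectorField {C : ℝ≥0} {B : L2 N →L[ℝ] L2 N} (hB : ‖B‖₊ ≤ C) :
    LipschitzWith (‖mulOp hX ∘L T - mulOp hh‖₊ + ‖mulOp hX‖₊ * (L * C))
      (vectorField hX hX₂ hh hg T B) := by
  have h1 := (mulOp hX ∘L T - mulOp hh).lipschitz
  have h2 := (((mulOp hX).lipschitz.comp (((lipschitzWith_sub_apply_zero hg).lipschitzWith_compLp
    (p := 2) (μ := (volume : Measure (E N))) (sub_self _)).comp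
      (B.lipschitz.weaken hB))).add (LipschitzWith.const (g 0 • hX₂.toLp X)))
  rw [add_zero] at h2
  exact h1.add h2

lemma tendsto_vectorField {ι : Type*} {l : Filter ι} {M : ι → L2 N →L[ℝ] L2 N}
    {Q : L2 N →L[ℝ] L2 N} {u : L2 N} (hM : Tendsto (fun i => M i u) l (𝓝 (Q u))) :
    Tendsto (fun i => vectorField hX hX₂ hh hg T (M i) u) l
      (𝓝 (vectorField hX hX₂ hh hg T Q u)) := by
  have h1 := (((mulOp hX).continuous.comp ((lipschitzWith_sub_apply_zero hg).continuous_compLp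
    (p := 2) (μ := (volume : Measure (E N))) (sub_self _))).tendsto (Q u)).comp hM
  exact (h1.add_const (g 0 • hX₂.toLp X)).const_add (mulOp hX (T u) - mulOp hh u)

/-- Being a solution of the evolution problem amounts to being an integral curve of the
corresponding vector field on `L²`. -/
theorem isSolution_iff (hΩ : IsOpen Ω) (hX₀ : ∀ x, x ∉ Ω → X x = 0)
    (hh₀ : MemLp (Ω.indicator h₀) ∞ (volume : Measure (E N)))
    (hT : ∀ f : L2 N, T f =ᵐ[volume] fun x => ∫ y, J (x - y) * f y)
    {B : L2 N →L[ℝ] L2 N} {F : (E N → ℝ) → E N → ℝ}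
    (hF : ∀ u : L2 N, (∀ᵐ x, x ∉ Ω → u x = 0) → ∀ᵐ x, x ∈ Ω → F u x = g (B u x))
    {z : L2 N} (hz : z =ᵐ[volume] Ω.indicator fun x => X x * u₀ x) (u : ℝ → L2 N) :
    IsSolution Ω J X h₀ u₀ F u ↔
      u 0 = z ∧ ∀ t, HasDerivAt u (vectorField hX hX₂ hh₀ hg T B (u t)) t := by
  -- Vanishing outside `Ω` becomes the closed linear condition `P u = u`, where `P` is
  -- multiplication by `1_Ω`; it can then be differentiated in time.
  have hP : MemLp (Ω.indicator fun _ => (1 : ℝ)) ∞ (volume : Measure (E N)) :=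
    (memLp_top_const 1).indicator hΩ.measurableSet
  have hPiff : ∀ f : L2 N, mulOp hP f = f ↔ ∀ᵐ x, x ∉ Ω → f x = 0 := by
    intro f
    rw [Lp.ext_iff]
    constructor
    · intro hf
      filter_upwards [hf, coeFn_mulOp hP f] with x h1 h2 hx
      rw [← h1, h2, Set.indicator_of_notMem hx, zero_mul]
    · intro hf
      filter_upwards [hf, coeFn_mulOp hP f] with x h1 h2
      rw [h2]
      by_cases hx : x ∈ Ω
      · rw [Set.indicator_of_mem hx, one_mul]
      · rw [h1 hx, mul_zero]
  have hfield : ∀ f : L2 N, ∀ᵐ x, x ∉ Ω → vectorField hX hX₂ hh₀ hg T B f x = 0 := by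
    intro f
    filter_upwards [coeFn_vectorField hX hX₂ hh₀ hg T B f] with x hx hxΩ
    simp [hx, hX₀ x hxΩ, hxΩ]
  constructor
  · intro hu
    have hd : ∀ t, HasDerivAt u (deriv u t) t := fun t =>
      (hu.contDiff.differentiable one_ne_zero t).hasDerivAt
    have hPu : ∀ t, mulOp hP (u t) = u t := fun t => (hPiff _).2 (hu.eq_zero t)
    refine ⟨?_, fun t => ?_⟩
    · refine Lp.ext ?_
      filter_upwards [hz, hu.initial, hu.eq_zero 0] with x h1 h2 h3
      rw [h1]
      by_cases hx : x ∈ Ω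
      · rw [Set.indicator_of_mem hx, h2 hx]
      · rw [Set.indicator_of_notMem hx, h3 hx]
    · have h1 : mulOp hP (deriv u t) = deriv u t := by
        have h2 := (mulOp hP).hasFDerivAt.comp_hasDerivAt t (hd t)
        have h3 : (⇑(mulOp hP) ∘ u) = u := funext hPu
        rw [h3] at h2
        exact h2.unique (hd t)
      have h4 : deriv u t = vectorField hX hX₂ hh₀ hg T B (u t) := by
        refine Lp.ext ?_
        filter_upwards [(hPiff _).1 h1, hfield (u t), hu.equation t, hF (u t) (hu.eq_zero t),
          coeFn_vectorField hX hX₂ hh₀ hg T B (u t), hT (u t)] with x a1 a2 a3 a4 a5 a6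
        by_cases hx : x ∈ Ω
        · rw [a3 hx, a5, a6, Set.indicator_of_mem hx, a4 hx]
        · rw [a1 hx, a2 hx]
      rw [← h4]
      exact hd t
  · rintro ⟨hu0, hu⟩
    have huc : Continuous u := continuous_iff_continuousAt.2 fun t => (hu t).continuousAt
    have hderiv : deriv u = fun t => vectorField hX hX₂ hh₀ hg T B (u t) :=
      funext fun t => (hu t).deriv
    -- The field takes values in the range of `P`, so `P u - u` has zero derivative, and it vanishes
    -- at `t = 0`.
    have hPu : ∀ t, mulOp hP (u t) = u t := by
      have h1 : ∀ t, HasDerivAt (fun t => mulOp hP (u t) - u t) 0 t := by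
        intro t
        have h2 := ((mulOp hP).hasFDerivAt.comp_hasDerivAt t (hu t)).sub (hu t)
        rw [(hPiff _).2 (hfield (u t)), sub_self] at h2
        exact h2
      intro t
      have h3 := is_const_of_deriv_eq_zero (fun t => (h1 t).differentiableAt)
        (fun t => (h1 t).deriv) t 0
      have h4 : mulOp hP (u 0) = u 0 := by
        rw [hPiff, hu0]
        filter_upwards [hz] with x hx hxΩ
        rw [hx, Set.indicator_of_notMem hxΩ]
      rw [h4, sub_self] at h3
      exact sub_eq_zero.1 h3
    have hzero : ∀ t, ∀ᵐ x, x ∉ Ω → u t x = 0 := fun t => (hPiff _).1 (hPu t)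
    refine ⟨?_, hzero, ?_, fun t => ?_⟩
    · rw [contDiff_one_iff_deriv]
      refine ⟨fun t => (hu t).differentiableAt, ?_⟩
      rw [hderiv]
      exact (lipschitzWith_vectorField hX hX₂ hh₀ hg T le_rfl).continuous.comp huc
    · rw [hu0]
      filter_upwards [hz] with x hx hxΩ
      rw [hx, Set.indicator_of_mem hxΩ]
    · rw [hderiv]
      filter_upwards [hF (u t) (hzero t), coeFn_vectorField hX hX₂ hh₀ hg T B (u t), hT (u t)]
        with x a1 a2 a3 hx
      rw [a2, a3, Set.indicator_of_mem hx, a1 hx]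

end VectorField

/-- Uniform convergence in `C([a,b]; L²)` implies weak* convergence in `L^∞([a,b]; L²(Ω))`. -/
theorem weakStarTendsto_of_tendstoUniformlyOn {a b : ℝ} {u : ℝ → ℝ → L2 N} {v : ℝ → L2 N}
    (hu : ∀ δ, 0 < δ → Continuous (u δ)) (hv : Continuous v)
    (huv : TendstoUniformlyOn u v (𝓝[>] 0) (Set.Icc a b)) : WeakStarTendsto Ω a b u v := by
  intro φ hφ
  let R := LpToLpRestrictCLM (E N) ℝ ℝ (volume : Measure (E N)) 2 Ω
  have hR : ∀ (f : Lp ℝ 2 ((volume : Measure (E N)).restrict Ω)) (w : L2 N),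
      ∫ x in Ω, f x * w x = inner ℝ f (R w) := by
    intro f w
    rw [L2.inner_def]
    refine integral_congr_ae ?_
    filter_upwards [LpToLpRestrictCLM_coeFn ℝ Ω w] with x hx
    rw [hx, RCLike.inner_apply, conj_trivial, mul_comm]
  simp_rw [hR]
  obtain ⟨D, hD⟩ := (isCompact_Icc (a := a) (b := b)).exists_bound_of_continuousOn hv.continuousOn
  rw [Metric.tendstoUniformlyOn_iff] at huv
  -- `D` bounds `v` on `[a,b]`, and `u δ` is eventually within `1` of `v` there, whence `D + 1`.
  refine tendsto_integral_filter_of_dominated_convergence (fun t => ‖φ t‖ * (‖R‖ * (D + 1)))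
    ?_ ?_ (hφ.norm.mul_const _) ?_
  · filter_upwards [self_mem_nhdsWithin] with δ hδ
    exact hφ.aestronglyMeasurable.inner (R.continuous.comp (hu δ hδ)).aestronglyMeasurable
  · filter_upwards [huv 1 one_pos] with δ hδ
    filter_upwards [ae_restrict_mem measurableSet_Icc] with t ht
    refine (norm_inner_le_norm _ _).trans ?_
    gcongr
    refine (R.le_opNorm _).trans ?_
    gcongr
    have h1 := hδ t ht
    rw [dist_comm, dist_eq_norm] at h1
    have h2 := norm_le_insert' (u δ t) (v t)
    linarith [hD t ht]
  · filter_upwards [ae_restrict_mem measurableSet_Icc] with t ht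
    have h1 : Tendsto (fun δ => u δ t) (𝓝[>] 0) (𝓝 (v t)) :=
      (Metric.tendstoUniformlyOn_iff.2 huv).tendsto_at ht
    exact tendsto_const_nhds.inner ((R.continuous.tendsto _).comp h1)

end Evolution

end NonlocalPerforated

end

theorem theorem2p3 {N : ℕ} (Ω : Set (NonlocalPerforated.E N))
    (hΩ_open : IsOpen Ω) (hΩ_bdd : Bornology.IsBounded Ω)
    (J X u₀ h₀ : NonlocalPerforated.E N → ℝ) (g : ℝ → ℝ)
    (hJ : NonlocalPerforated.IsKernel J) (hJ_smooth : ContDiff ℝ 1 J)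
    (hX : NonlocalPerforated.IsDensity Ω X) (hX_smooth : ContDiffOn ℝ 1 X Ω)
    (hu₀ : MemLp u₀ 2 (volume.restrict Ω)) (hu₀_smooth : ContDiffOn ℝ 1 u₀ Ω)
    (hg_lip : ∃ L : ℝ≥0, LipschitzWith L g) (hg_smooth : ContDiff ℝ 2 g)
    (hh₀ : h₀ = NonlocalPerforated.hDirichlet ∨ h₀ = NonlocalPerforated.hNeumann Ω J X) :
    (∀ δ : ℝ, 0 < δ → ∃! u : ℝ → NonlocalPerforated.L2 N,
      NonlocalPerforated.IsSolution Ω J X h₀ u₀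
        (NonlocalPerforated.nonlocalReaction X g δ) u) ∧
    ∀ u : ℝ → ℝ → NonlocalPerforated.L2 N,
      (∀ δ : ℝ, 0 < δ → NonlocalPerforated.IsSolution Ω J X h₀ u₀
        (NonlocalPerforated.nonlocalReaction X g δ) (u δ)) →
      ∃ v : ℝ → NonlocalPerforated.L2 N,
        (∀ a b : ℝ, a ≤ b → NonlocalPerforated.WeakStarTendsto Ω a b u v) ∧
        NonlocalPerforated.IsSolution Ω J X h₀ u₀
          (NonlocalPerforated.localReaction X g) v := by
  open NonlocalPerforated in
  obtain ⟨L, hg⟩ := hg_lip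
  have hXc := hX_smooth.continuousOn
  have hX₂ := hX.memLp hΩ_open hΩ_bdd 2
  have hh : MemLp (Ω.indicator h₀) ∞ (volume : Measure (E N)) := by
    refine MemLp.indicator hΩ_open.measurableSet ?_
    rcases hh₀ with rfl | rfl
    · exact memLp_top_const 1
    · exact memLp_hNeumann hΩ_open hJ hX (hX.measurable hΩ_open hXc)
  have hz : MemLp (Ω.indicator fun x => X x * u₀ x) 2 (volume : Measure (E N)) := by
    rw [memLp_indicator_iff_restrict hΩ_open.measurableSet]
    exact hu₀.mul (hX.memLp_top.restrict Ω)
  obtain ⟨T, hT⟩ := hJ.exists_convolutionOperator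
  obtain ⟨C, M, hM, hMf⟩ := exists_meanOperator hX hΩ_open hΩ_bdd hXc
  set Q := mulOp (memLp_inv_density hX hΩ_open hXc) with hQ
  let V : (L2 N →L[ℝ] L2 N) → L2 N → L2 N := vectorField hX.memLp_top hX₂ hh hg T
  have hsolM : ∀ (δ : ℝ) (u : ℝ → L2 N),
      IsSolution Ω J X h₀ u₀ (nonlocalReaction X g δ) u ↔
        u 0 = hz.toLp _ ∧ ∀ t, HasDerivAt u (V (M δ) (u t)) t := by
    intro δ u
    refine isSolution_iff hX.memLp_top hX₂ hg T hΩ_open hX.eq_zero hh hT ?_ hz.coeFn_toLp u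
    intro f hf
    have hmean : ∀ x, mean X δ f x = mean X δ (Ω.indicator f) x := by
      intro x
      unfold mean
      congr 1
      refine integral_congr_ae (ae_restrict_of_ae ?_)
      filter_upwards [hf] with y hy
      by_cases hyΩ : y ∈ Ω
      · rw [Set.indicator_of_mem hyΩ]
      · rw [Set.indicator_of_notMem hyΩ, hy hyΩ]
    filter_upwards [hMf δ f] with x hx hxΩ
    rw [hx, Set.indicator_of_mem hxΩ, nonlocalReaction, hmean]
  have hsolQ : ∀ u : ℝ → L2 N, IsSolution Ω J X h₀ u₀ (localReaction X g) u ↔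
      u 0 = hz.toLp _ ∧ ∀ t, HasDerivAt u (V Q (u t)) t := by
    intro u
    refine isSolution_iff hX.memLp_top hX₂ hg T hΩ_open hX.eq_zero hh hT ?_ hz.coeFn_toLp u
    intro f _
    filter_upwards [coeFn_mulOp (memLp_inv_density hX hΩ_open hXc) f] with x hx _
    rw [hx, localReaction, div_eq_inv_mul]
  -- The maximum gives the nonlocal fields and the limit field a common Lipschitz constant.
  have hlip : ∀ B : L2 N →L[ℝ] L2 N, ‖B‖₊ ≤ max C ‖Q‖₊ → LipschitzWith _ (V B) := fun B hB =>
    lipschitzWith_vectorField hX.memLp_top hX₂ hh hg T hB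
  have hMC : ∀ δ, ‖M δ‖₊ ≤ max C ‖Q‖₊ := fun δ => (show ‖M δ‖₊ ≤ C from hM δ).trans (le_max_left _ _)
  have hQC : ‖Q‖₊ ≤ max C ‖Q‖₊ := le_max_right _ _
  refine ⟨fun δ _ => ?_, fun u hu => ?_⟩
  · obtain ⟨u, hu0, hu⟩ := exists_forall_hasDerivAt_of_lipschitzWith (hlip _ (hMC δ)) (hz.toLp _)
    refine ⟨u, (hsolM δ u).2 ⟨hu0, hu⟩, fun w hw => ?_⟩
    obtain ⟨hw0, hw⟩ := (hsolM δ w).1 hw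
    exact ODE_solution_unique_univ (v := fun _ => V (M δ)) (s := fun _ => Set.univ) (t₀ := 0)
      (fun _ => (hlip _ (hMC δ)).lipschitzOnWith) (fun t => ⟨hw t, trivial⟩)
      (fun t => ⟨hu t, trivial⟩) (hw0.trans hu0.symm)
  · obtain ⟨v, hv0, hv⟩ := exists_forall_hasDerivAt_of_lipschitzWith (hlip _ hQC) (hz.toLp _)
    have hvsol := (hsolQ v).2 ⟨hv0, hv⟩
    refine ⟨v, fun a b _ => ?_, hvsol⟩
    refine weakStarTendsto_of_tendstoUniformlyOn (fun δ hδ => (hu δ hδ).contDiff.continuous)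
      hvsol.contDiff.continuous ?_
    refine tendstoUniformlyOn_of_equiLipschitz (V := fun δ => V (M δ))
      (Eventually.of_forall fun δ => hlip _ (hMC δ)) (hlip _ hQC) (fun f => ?_) ?_ hv ?_ a b
    · exact tendsto_vectorField hX.memLp_top hX₂ hh hg T
        (tendsto_meanOperator hX hΩ_open hΩ_bdd hXc hM hMf f)
    · filter_upwards [self_mem_nhdsWithin] with δ hδ
      exact ((hsolM δ _).1 (hu δ hδ)).2
    · filter_upwards [self_mem_nhdsWithin] with δ hδ
      rw [((hsolM δ _).1 (hu δ hδ)).1, hv0]
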